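/- Let $k$ be a field and let $m_0<m_1<m_2<m_3$ be positive integers with $\gcd(m_0,m_1,m_2,m_3)=1$ that form an arithmetic progression with common difference $d$, i.e. $m_i=m_0+id$ for $0\le i\le 3$, where $m_0=3a+b$ with integers $a\ge 1$ and $b\in\{1,2,3\}$. Let $C\subset\mathbb{A}^4$ be the monomial curve $x_0=t^{m_0},\ x_1=t^{m_1},\ x_2=t^{m_2},\ y=t^{m_3}$, let $I(C)$ be the kernel of the $k$-algebra homomorphism $k[x_0,x_1,x_2,y]\to k[t]$, $x_i\mapsto t^{m_i}$, $y\mapsto t^{m_3}$, and let $I(C)^*$ be the ideal generated by the forms $f^*$ for $f\in I(C)$, where $f^*$ is the homogeneous summand of $f$ of least degree (with $0^*=0$). Let $A=k[[t^{m_0},t^{m_1},t^{m_2},t^{m_3}]]$ be the ring of formal power series in $t$ whose exponents all lie in the semigroup generated by $m_0,\dots,m_3$, let $\mathfrak m=(t^{m_0},t^{m_1},t^{m_2},t^{m_3})$ be its maximal ideal, and let $\mathrm{gr}_{\mathfrak m}(A)=\bigoplus_{i\ge 0}\mathfrak m^i/\mathfrak m^{i+1}$. Then there is an isomorphism of $k$-algebras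 $$k[x_0,x_1,x_2,y]/I(C)^*\;\cong\;\mathrm{gr}_{\mathfrak m}(A)$$ sending the classes of $x_0,x_1,x_2,y$ to the classes of $t^{m_0},t^{m_1},t^{m_2},t^{m_3}$ in $\mathfrak m/\mathfrak m^2$, and the tangent cone of $C$ at the origin is Cohen–Macaulay: both of these rings are Cohen–Macaulay (i.e. Noetherian, with the depth of the localization at every maximal ideal equal to its Krull dimension). -/

import Mathlib

noncomputable section

namespace MonomialCurve

/-- The depth of a local ring: the supremum of the lengths of the regular sequences that are
contained in its maximal ideal. -/
def localDepth (R : Type*) [CommRing R] [IsLocalRing R] : ℕ∞ :=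
  ⨆ (rs : List R) (_ : (∀ r ∈ rs, r ∈ IsLocalRing.maximalIdeal R) ∧
    RingTheory.Sequence.IsRegular R rs), (rs.length : ℕ∞)

/-- A Noetherian local ring is Cohen-Macaulay if its depth equals its Krull dimension. -/
def IsCohenMacaulayLocalRing (R : Type*) [CommRing R] [IsLocalRing R] : Prop :=
  IsNoetherianRing R ∧ ((localDepth R : ℕ∞) : WithBot ℕ∞) = ringKrullDim R

/-- A commutative ring is Cohen-Macaulay if it is Noetherian and its localization at every
maximal ideal is a Cohen-Macaulay local ring. -/
def IsCohenMacaulayRing (R : Type*) [CommRing R] : Prop :=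
  IsNoetherianRing R ∧ ∀ (P : Ideal R) [P.IsMaximal],
    IsCohenMacaulayLocalRing (Localization.AtPrime P)

/-- The associated graded ring `gr_I(R) = ⨁ₙ Iⁿ / Iⁿ⁺¹`, as the quotient `R[IT] / I R[IT]` of the
Rees algebra `R[IT] = ⨁ₙ Iⁿ Tⁿ` (the degree `n` part of `I R[IT]` is `Iⁿ⁺¹ Tⁿ`). -/
abbrev AssociatedGradedRing {R : Type*} [CommRing R] (I : Ideal R) : Type _ :=
  reesAlgebra I ⧸ I.map (algebraMap R (reesAlgebra I))

/-- The class in `Iⁿ / Iⁿ⁺¹ ⊆ gr_I(R)` of an element of `Iⁿ`. -/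
def toGraded {R : Type*} [CommRing R] (I : Ideal R) (n : ℕ) (x : R) (hx : x ∈ I ^ n) :
    AssociatedGradedRing I :=
  Ideal.Quotient.mk _ ⟨Polynomial.monomial n x, reesAlgebra.monomial_mem.2 hx⟩

variable (k : Type*) [Field k] {n : ℕ} (m : Fin n → ℕ)

/-- The `k`-algebra homomorphism `φ : k[x₀, …, xₙ₋₁] → k[t]`, `xᵢ ↦ t ^ mᵢ`. -/
def parametrization : MvPolynomial (Fin n) k →ₐ[k] Polynomial k :=
  MvPolynomial.aeval fun i => (Polynomial.X : Polynomial k) ^ m i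

/-- The defining ideal `I(C) = Ker φ` of the monomial curve `C`. -/
def definingIdeal : Ideal (MvPolynomial (Fin n) k) :=
  RingHom.ker (parametrization k m)

variable {k} in
/-- `f^*`: the homogeneous summand of `f` of least degree (it is `0` for `f = 0`). -/
def leastForm (f : MvPolynomial (Fin n) k) : MvPolynomial (Fin n) k :=
  MvPolynomial.homogeneousComponent
    (sInf {j : ℕ | MvPolynomial.homogeneousComponent j f ≠ 0}) f

/-- The ideal `I(C)^*` of the tangent cone of `C` at the origin: it is generated by the `f^*`
for `f` in `I(C)`. -/
def tangentConeIdeal : Ideal (MvPolynomial (Fin n) k) :=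
  Ideal.span (leastForm '' (definingIdeal k m : Set (MvPolynomial (Fin n) k)))

/-- The additive semigroup (with `0`) generated by the exponents `mᵢ`. -/
def exponentSemigroup : AddSubmonoid ℕ :=
  AddSubmonoid.closure (Set.range m)

/-- The ring `A = k[[t ^ m₀, …, t ^ mₙ₋₁]]`: the formal power series in `t` all of whose exponents
lie in the semigroup generated by the `mᵢ`. -/
def localRing : Subalgebra k (PowerSeries k) where
  carrier := {f | ∀ j : ℕ, PowerSeries.coeff j f ≠ 0 → j ∈ exponentSemigroup m}
  mul_mem' := by
    classical
    intro f g hf hg j hj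
    rw [PowerSeries.coeff_mul] at hj
    obtain ⟨p, hp, hne⟩ := Finset.exists_ne_zero_of_sum_ne_zero hj
    rw [← Finset.HasAntidiagonal.mem_antidiagonal.1 hp]
    exact add_mem (hf _ (left_ne_zero_of_mul hne)) (hg _ (right_ne_zero_of_mul hne))
  add_mem' := by
    intro f g hf hg j hj
    by_cases h : PowerSeries.coeff j f = 0
    · exact hg j (by simpa [h] using hj)
    · exact hf j h
  algebraMap_mem' := by
    classical
    intro r j hj
    rw [PowerSeries.algebraMap_apply, PowerSeries.coeff_C] at hj
    have h0 : j = 0 := by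
      by_contra h
      simp [h] at hj
    exact h0 ▸ zero_mem _

/-- The element `t ^ mᵢ` of `A`. -/
def generator (i : Fin n) : localRing k m :=
  ⟨(PowerSeries.X : PowerSeries k) ^ m i, by
    classical
    intro j hj
    rw [PowerSeries.coeff_X_pow] at hj
    have h : j = m i := by
      by_contra h
      simp [h] at hj
    exact h ▸ AddSubmonoid.subset_closure ⟨i, rfl⟩⟩

/-- The maximal ideal `(t ^ m₀, …, t ^ mₙ₋₁)` of `A`. -/
def maxIdeal : Ideal (localRing k m) :=
  Ideal.span (Set.range (generator k m))

theorem generator_mem (i : Fin n) : generator k m i ∈ maxIdeal k m ^ 1 := by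
  rw [pow_one]
  exact Ideal.subset_span ⟨i, rfl⟩

end MonomialCurve

end

noncomputable section

namespace MonomialCurve

/-! ### A Cohen–Macaulay criterion: finite and torsion-free over `k[X]`. -/

section CohenMacaulay

open Polynomial

/-! Everything is read off from exponents. A series lies in the `N`-th power of the maximal ideal
exactly when each of its exponents is a sum of at least `N` of the `mᵢ` (`maxIdeal_pow`). Hence a
form of degree `N` dies in the graded ring iff every exponent of its image in `k[t]` is a sum of at
least `N + 1` generators; such forms are exactly what least forms of elements of `I(C)` generate
(`ker_toAssociatedGraded`). With `toAssociatedGraded_surjective` this gives the isomorphism.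

For Cohen–Macaulayness, the tangent cone is finite and torsion-free over `k[x₀]`, so each
localization at a maximal ideal has dimension at most 1 and depth at least 1
(`isCohenMacaulayRing_of_finite`). Finiteness: the other variables are nilpotent, since `m₀ * mᵢ` is
also a sum of `mᵢ > m₀` copies of `m₀` (`X_pow_mem_tangentConeIdeal`). Torsion-freeness: `x₀` is a
nonzerodivisor because sums of `N` generators are exactly the numbers `N * m₀ + j * d` with `j ≤ 3 *
N`, and `d` is coprime to `m₀` (`mem_exponentsOfOrder_succ_of_add_mem`); homogeneity extends this to
nonzero polynomials in `x₀` (`aeval_mk_X_mem_nonZeroDivisors`). -/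

/-- In a Noetherian local ring, a regular sequence is not longer than the Krull dimension. -/
theorem localDepth_le_ringKrullDim (R : Type*) [CommRing R] [IsLocalRing R] [IsNoetherianRing R] :
    ((localDepth R : ℕ∞) : WithBot ℕ∞) ≤ ringKrullDim R := by
  have hne : ringKrullDim R ≠ ⊥ := ringKrullDim_ne_bot
  obtain ⟨N, hN⟩ := WithBot.ne_bot_iff_exists.1 hne
  rw [← hN, WithBot.coe_le_coe]
  refine iSup₂_le fun rs hrs => ?_
  have h := ringKrullDim_add_length_eq_ringKrullDim_of_isRegular rs hrs.2
  have : Nontrivial (R ⧸ Ideal.ofList rs) := by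
    refine Ideal.Quotient.nontrivial_iff.2 fun htop => hrs.2.top_ne_smul ?_
    rw [htop]; simp
  have h0 : (0 : WithBot ℕ∞) ≤ ringKrullDim (R ⧸ Ideal.ofList rs) :=
    ringKrullDim_nonneg_of_nontrivial
  have h1 : ((rs.length : ℕ∞) : WithBot ℕ∞) ≤ ringKrullDim R := by
    rw [← h]
    exact le_add_of_nonneg_left h0
  rwa [← hN, WithBot.coe_le_coe] at h1

/-- A local ring whose maximal ideal contains a nonzerodivisor has positive depth. -/
theorem one_le_localDepth {R : Type*} [CommRing R] [IsLocalRing R] {x : R}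
    (hx : x ∈ IsLocalRing.maximalIdeal R) (hreg : x ∈ nonZeroDivisors R) :
    1 ≤ localDepth R := by
  refine le_iSup₂_of_le [x] ⟨by simpa using hx, ?_⟩ (by simp)
  refine ⟨?_, ?_⟩
  · rw [RingTheory.Sequence.isWeaklyRegular_cons_iff]
    refine ⟨?_, RingTheory.Sequence.IsWeaklyRegular.nil _ _⟩
    intro a b hab
    exact (mul_cancel_left_mem_nonZeroDivisors hreg).1 hab
  · intro htop
    have h1 : (1 : R) ∈ Ideal.ofList [x] • (⊤ : Submodule R R) := htop ▸ Submodule.mem_top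
    have h2 : Ideal.ofList [x] ≤ IsLocalRing.maximalIdeal R := by
      simpa [Ideal.ofList_singleton, Ideal.span_le] using hx
    have h3 : (1 : R) ∈ IsLocalRing.maximalIdeal R := by
      apply h2
      simpa using h1
    exact (Ideal.ne_top_iff_one _).1 (IsLocalRing.maximalIdeal.isMaximal R).ne_top h3

/-- The Krull dimension does not increase along an integral ring homomorphism. -/
theorem ringKrullDim_le_of_isIntegral {R S : Type*} [CommRing R] [CommRing S] [Algebra R S]
    [Algebra.IsIntegral R S] : ringKrullDim S ≤ ringKrullDim R :=
  Order.krullDim_le_of_strictMono (PrimeSpectrum.comap (algebraMap R S)) fun p q hpq => by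
    exact Ideal.IsIntegral.comap_lt_comap (R := R) (I := p.asIdeal) (J := q.asIdeal) hpq

/-- A ring that is finite and torsion-free over `k[X]` is Cohen-Macaulay. -/
theorem isCohenMacaulayRing_of_finite {k B : Type*} [Field k] [CommRing B]
    (φ : k[X] →+* B) (hfin : φ.Finite) (hreg : ∀ p : k[X], p ≠ 0 → φ p ∈ nonZeroDivisors B) :
    IsCohenMacaulayRing B := by
  algebraize [φ]
  have : Module.Finite k[X] B := hfin
  have hnoeth : IsNoetherianRing B := IsNoetherianRing.of_finite k[X] B
  refine ⟨hnoeth, fun P hP => ?_⟩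
  have hN : IsNoetherianRing (Localization.AtPrime P) :=
    IsLocalization.isNoetherianRing P.primeCompl _ hnoeth
  refine ⟨hN, le_antisymm (localDepth_le_ringKrullDim _) ?_⟩
  have hdim : ringKrullDim (Localization.AtPrime P) ≤ 1 := by
    rw [IsLocalization.AtPrime.ringKrullDim_eq_height P]
    refine (Ideal.height_le_ringKrullDim_of_ne_top hP.ne_top).trans ?_
    refine (ringKrullDim_le_of_isIntegral (R := k[X])).trans ?_
    exact (IsPrincipalIdealRing.ringKrullDim_eq_one k[X] (Polynomial.not_isField k)).le
  refine hdim.trans ?_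
  -- `P` contracts to a maximal, hence nonzero, ideal of `k[X]`; any nonzero `p` in it yields a
  -- nonzerodivisor inside `P`.
  have hmax : (P.comap (algebraMap k[X] B)).IsMaximal :=
    Ideal.isMaximal_comap_of_isIntegral_of_isMaximal P
  obtain ⟨p, hp, hp0⟩ := Submodule.exists_mem_ne_zero_of_ne_bot
    (Ring.ne_bot_of_isMaximal_of_not_isField hmax (Polynomial.not_isField k))
  have hpP : φ p ∈ P := hp
  have := one_le_localDepth (R := Localization.AtPrime P) (x := algebraMap B _ (φ p))
    ((IsLocalization.AtPrime.to_map_mem_maximal_iff _ P _).2 hpP)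
    (IsLocalization.map_nonZeroDivisors_le P.primeCompl _ ⟨_, hreg p hp0, rfl⟩)
  exact_mod_cast this

end CohenMacaulay

/-! ### Powers of the maximal ideal in terms of exponents. -/

section Exponents

variable (k : Type*) [Field k] {n : ℕ} (m : Fin n → ℕ)

/-- The exponents that are sums of at least `N` of the `mᵢ`. -/
def exponentsOfOrder (N : ℕ) : Set ℕ :=
  {s | ∃ c : Fin n →₀ ℕ, N ≤ c.degree ∧ Finsupp.weight m c = s}

variable {m} in
theorem exponentsOfOrder_anti {M N : ℕ} (h : M ≤ N) {s : ℕ} (hs : s ∈ exponentsOfOrder m N) :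
    s ∈ exponentsOfOrder m M := by
  obtain ⟨c, hc, rfl⟩ := hs
  exact ⟨c, h.trans hc, rfl⟩

variable {m} in
theorem add_mem_exponentsOfOrder {M N s t : ℕ} (hs : s ∈ exponentsOfOrder m M)
    (ht : t ∈ exponentsOfOrder m N) : s + t ∈ exponentsOfOrder m (M + N) := by
  obtain ⟨c, hc, rfl⟩ := hs
  obtain ⟨e, he, rfl⟩ := ht
  exact ⟨c + e, by rw [map_add]; exact add_le_add hc he, by rw [map_add]⟩

theorem self_mem_exponentsOfOrder_one (i : Fin n) : m i ∈ exponentsOfOrder m 1 :=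
  ⟨Finsupp.single i 1, by simp, by simp [Finsupp.weight_single]⟩

theorem mem_exponentSemigroup_iff {s : ℕ} :
    s ∈ exponentSemigroup m ↔ s ∈ exponentsOfOrder m 0 := by
  constructor
  · intro hs
    induction hs using AddSubmonoid.closure_induction with
    | mem x hx =>
      obtain ⟨i, rfl⟩ := hx
      exact exponentsOfOrder_anti (Nat.zero_le _) (self_mem_exponentsOfOrder_one m i)
    | zero => exact ⟨0, by simp, by simp⟩
    | add x y _ _ hx hy => exact add_mem_exponentsOfOrder hx hy
  · rintro ⟨c, -, rfl⟩
    rw [Finsupp.weight_apply]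
    refine sum_mem fun i _ => nsmul_mem (AddSubmonoid.subset_closure (Set.mem_range_self i)) _

variable {m} in
theorem exists_eq_add_of_mem_exponentsOfOrder_succ {N s : ℕ}
    (hs : s ∈ exponentsOfOrder m (N + 1)) :
    ∃ i, ∃ t ∈ exponentsOfOrder m N, t + m i = s := by
  obtain ⟨c, hc, rfl⟩ := hs
  have hc0 : c ≠ 0 := by
    rintro rfl
    simp at hc
  obtain ⟨i, hi⟩ := Finsupp.ne_iff.1 hc0
  have hle : Finsupp.single i 1 ≤ c := by
    rw [Finsupp.single_le_iff]
    exact Nat.one_le_iff_ne_zero.2 hi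
  obtain ⟨e, rfl⟩ := exists_add_of_le hle
  refine ⟨i, _, ⟨e, ?_, rfl⟩, ?_⟩
  · simp only [map_add, Finsupp.degree_single] at hc
    omega
  · simp [Finsupp.weight_single, add_comm]

/-- The power series in `A` all of whose exponents are sums of at least `N` of the `mᵢ`. -/
def supportIdeal (N : ℕ) : Ideal (localRing k m) where
  carrier := {f | ∀ j : ℕ, PowerSeries.coeff j (f : PowerSeries k) ≠ 0 → j ∈ exponentsOfOrder m N}
  zero_mem' := fun j hj => by simp at hj
  add_mem' := by
    intro f g hf hg j hj
    by_cases h : PowerSeries.coeff j (f : PowerSeries k) = 0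
    · exact hg j (by simpa [h] using hj)
    · exact hf j h
  smul_mem' := by
    classical
    intro f g hg j hj
    rw [smul_eq_mul, Subalgebra.coe_mul, PowerSeries.coeff_mul] at hj
    obtain ⟨p, hp, hne⟩ := Finset.exists_ne_zero_of_sum_ne_zero hj
    rw [← Finset.HasAntidiagonal.mem_antidiagonal.1 hp]
    have := add_mem_exponentsOfOrder
      ((mem_exponentSemigroup_iff m).1 (f.2 _ (left_ne_zero_of_mul hne)))
      (hg _ (right_ne_zero_of_mul hne))
    rwa [Nat.zero_add] at this

variable {k m} in
theorem mem_supportIdeal {N : ℕ} {f : localRing k m} : f ∈ supportIdeal k m N ↔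
    ∀ j : ℕ, PowerSeries.coeff j (f : PowerSeries k) ≠ 0 → j ∈ exponentsOfOrder m N :=
  Iff.rfl

theorem supportIdeal_zero : supportIdeal k m 0 = ⊤ :=
  (Ideal.eq_top_iff_one _).2 fun j hj =>
    (mem_exponentSemigroup_iff m).1 ((1 : localRing k m).2 j hj)

variable {k m} in
theorem mul_mem_supportIdeal {M N : ℕ} {f g : localRing k m} (hf : f ∈ supportIdeal k m M)
    (hg : g ∈ supportIdeal k m N) : f * g ∈ supportIdeal k m (M + N) := by
  classical
  intro j hj
  rw [Subalgebra.coe_mul, PowerSeries.coeff_mul] at hj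
  obtain ⟨p, hp, hne⟩ := Finset.exists_ne_zero_of_sum_ne_zero hj
  rw [← Finset.HasAntidiagonal.mem_antidiagonal.1 hp]
  exact add_mem_exponentsOfOrder (hf _ (left_ne_zero_of_mul hne)) (hg _ (right_ne_zero_of_mul hne))

theorem generator_mem_supportIdeal (i : Fin n) : generator k m i ∈ supportIdeal k m 1 := by
  classical
  intro j hj
  simp only [generator, PowerSeries.coeff_X_pow] at hj
  have h : j = m i := by
    by_contra h
    simp [h] at hj
  exact h ▸ self_mem_exponentsOfOrder_one m i

theorem maxIdeal_le_supportIdeal : maxIdeal k m ≤ supportIdeal k m 1 :=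
  Ideal.span_le.2 (Set.range_subset_iff.2 (generator_mem_supportIdeal k m))

/-- A power series whose exponents are sums of at least `N + 1` of the `mᵢ` is a combination of
the `t ^ mᵢ` with coefficients whose exponents are sums of at least `N` of the `mᵢ`. -/
theorem supportIdeal_succ_le (N : ℕ) :
    supportIdeal k m (N + 1) ≤ supportIdeal k m N * maxIdeal k m := by
  classical
  intro f hf
  -- The total choice of a generator below needs `Fin n` inhabited; without generators no exponent
  -- has positive order.
  rcases isEmpty_or_nonempty (Fin n) with hn | hn
  · have : f = 0 := by
      ext j
      by_contra hj
      obtain ⟨i, -⟩ := exists_eq_add_of_mem_exponentsOfOrder_succ (hf j hj)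
      exact hn.false i
    rw [this]
    exact zero_mem _
  choose! i t ht hit using fun (s : ℕ) (hs : s ∈ exponentsOfOrder m (N + 1)) =>
    exists_eq_add_of_mem_exponentsOfOrder_succ hs
  have hcoeff : ∀ (l : Fin n) (j : ℕ), (if i (j + m l) = l then
      PowerSeries.coeff (j + m l) (f : PowerSeries k) else 0) ≠ 0 → j ∈ exponentsOfOrder m N := by
    intro l j hj
    obtain ⟨hl, hj⟩ := ite_ne_right_iff.1 hj
    have hs := hf _ hj
    have h := hit _ hs
    rw [hl] at h
    exact (add_right_cancel h) ▸ ht _ hs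
  -- Each exponent `s` of `f` is assigned to one generator `i s`; `g l` collects the terms assigned
  -- to `l`, shifted down by `m l`, so the sum below counts every term of `f` once.
  let g : Fin n → localRing k m := fun l =>
    ⟨PowerSeries.mk fun j => if i (j + m l) = l then
      PowerSeries.coeff (j + m l) (f : PowerSeries k) else 0, fun j hj => by
        rw [PowerSeries.coeff_mk] at hj
        exact (mem_exponentSemigroup_iff m).2
          (exponentsOfOrder_anti (Nat.zero_le _) (hcoeff l j hj))⟩
  have hg : ∀ l, g l ∈ supportIdeal k m N := fun l j hj => by
    simp only [g, PowerSeries.coeff_mk] at hj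
    exact hcoeff l j hj
  have hsum : f = ∑ l, g l * generator k m l := by
    ext j
    rw [AddSubmonoidClass.coe_finsetSum, map_sum]
    simp only [Subalgebra.coe_mul, g, generator, PowerSeries.coeff_mul_X_pow',
      PowerSeries.coeff_mk]
    by_cases hj : PowerSeries.coeff j (f : PowerSeries k) = 0
    · rw [hj, Finset.sum_eq_zero]
      intro l _
      split_ifs with h1 h2
      · rw [Nat.sub_add_cancel h1, hj]
      · rfl
      · rfl
    · have hle : m (i j) ≤ j := (Nat.le_add_left _ _).trans (hit j (hf j hj)).le
      rw [Finset.sum_eq_single (i j)]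
      · simp [hle]
      · intro l _ hl
        split_ifs with h1 h2
        · rw [Nat.sub_add_cancel h1] at h2
          exact absurd h2.symm hl
        · rfl
        · rfl
      · simp
  rw [hsum]
  exact sum_mem fun l _ => Ideal.mul_mem_mul (hg l) (Ideal.subset_span ⟨l, rfl⟩)

/-- The powers of the maximal ideal of `A` are determined by the exponents. -/
theorem maxIdeal_pow (N : ℕ) : maxIdeal k m ^ N = supportIdeal k m N := by
  induction N with
  | zero => rw [pow_zero, supportIdeal_zero, Ideal.one_eq_top]
  | succ N ih =>
    rw [pow_succ, ih]
    refine le_antisymm (Ideal.mul_le.2 fun f hf g hg => ?_) (supportIdeal_succ_le k m N)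
    exact mul_mem_supportIdeal hf (maxIdeal_le_supportIdeal k m hg)

end Exponents

/-! ### The tangent cone as the associated graded ring. -/

section TangentCone

section ReesAlgebra

variable {R : Type*} [CommRing R] {I : Ideal R}

/-- By additivity it suffices to treat `a * b` with `a ∈ I` and `b ∈ I ^ n`, where `a` factors out
as a scalar from `I`. -/
theorem monomial_mem_map_algebraMap_reesAlgebra {n : ℕ} {x : R} (hx : x ∈ I ^ (n + 1)) :
    ∀ h : Polynomial.monomial n x ∈ reesAlgebra I,
      (⟨Polynomial.monomial n x, h⟩ : reesAlgebra I) ∈ I.map (algebraMap R (reesAlgebra I)) := by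
  rw [pow_succ'] at hx
  induction hx using Submodule.mul_induction_on' with
  | mem_mul_mem a ha b hb =>
    intro h
    have : (⟨Polynomial.monomial n (a * b), h⟩ : reesAlgebra I) =
        algebraMap R (reesAlgebra I) a *
          ⟨Polynomial.monomial n b, reesAlgebra.monomial_mem.2 hb⟩ := by
      apply Subtype.ext
      change Polynomial.monomial n (a * b) = Polynomial.C a * Polynomial.monomial n b
      rw [Polynomial.C_mul_monomial]
    rw [this]
    exact Ideal.mul_mem_right _ _ (Ideal.mem_map_of_mem _ ha)
  | add x hx y hy ihx ihy =>
    intro h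
    rw [← pow_succ'] at hx hy
    have hx' := reesAlgebra.monomial_mem.2 (Ideal.pow_le_pow_right (Nat.le_succ n) hx)
    have hy' := reesAlgebra.monomial_mem.2 (Ideal.pow_le_pow_right (Nat.le_succ n) hy)
    have : (⟨Polynomial.monomial n (x + y), h⟩ : reesAlgebra I) =
        ⟨Polynomial.monomial n x, hx'⟩ + ⟨Polynomial.monomial n y, hy'⟩ :=
      Subtype.ext (map_add _ _ _)
    rw [this]
    exact add_mem (ihx _) (ihy _)

/-- The degree `n` part of `I R[IT]` is `Iⁿ⁺¹ Tⁿ`. -/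
theorem mem_map_algebraMap_reesAlgebra_iff (y : reesAlgebra I) :
    y ∈ I.map (algebraMap R (reesAlgebra I)) ↔
      ∀ n, (y : Polynomial R).coeff n ∈ I ^ (n + 1) := by
  constructor
  · intro hy
    induction hy using Submodule.span_induction with
    | mem y hy =>
      obtain ⟨a, ha, rfl⟩ := hy
      intro n
      change (Polynomial.C a).coeff n ∈ _
      rw [Polynomial.coeff_C]
      split_ifs with h
      · simpa [h] using ha
      · exact zero_mem _
    | zero => simp
    | add y z _ _ ihy ihz =>
      intro n
      rw [Subalgebra.coe_add, Polynomial.coeff_add]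
      exact add_mem (ihy n) (ihz n)
    | smul b y _ ih =>
      intro n
      rw [smul_eq_mul, Subalgebra.coe_mul, Polynomial.coeff_mul]
      refine sum_mem fun p hp => ?_
      rw [← Finset.HasAntidiagonal.mem_antidiagonal.1 hp, add_assoc, pow_add]
      exact Ideal.mul_mem_mul (b.2 _) (ih _)
  · intro hy
    have : y = ∑ n ∈ (y : Polynomial R).support,
        ⟨Polynomial.monomial n ((y : Polynomial R).coeff n), reesAlgebra.monomial_mem.2 (y.2 n)⟩ := by
      apply Subtype.ext
      rw [AddSubmonoidClass.coe_finsetSum]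
      exact (y : Polynomial R).as_sum_support
    rw [this]
    exact sum_mem fun n _ => monomial_mem_map_algebraMap_reesAlgebra (hy n) _

end ReesAlgebra

/-- Evaluation at `rᵢ T` separates the homogeneous components. -/
theorem coeff_aeval_monomial_one {k σ R : Type*} [CommSemiring k] [CommSemiring R] [Algebra k R]
    (r : σ → R) (f : MvPolynomial σ k) (N : ℕ) :
    (MvPolynomial.aeval (fun i => Polynomial.monomial 1 (r i)) f).coeff N =
      MvPolynomial.aeval r (MvPolynomial.homogeneousComponent N f) := by
  induction f using MvPolynomial.induction_on' with
  | monomial c a =>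
    have h1 : MvPolynomial.aeval (fun i => Polynomial.monomial 1 (r i)) (MvPolynomial.monomial c a) =
        Polynomial.monomial c.degree (MvPolynomial.aeval r (MvPolynomial.monomial c a)) := by
      rw [MvPolynomial.aeval_monomial, MvPolynomial.aeval_monomial]
      simp only [← Polynomial.C_mul_X_pow_eq_monomial, mul_pow, Finsupp.prod, pow_one,
        Finset.prod_mul_distrib, Finset.prod_pow_eq_pow_sum, map_mul, map_prod, map_pow,
        Finsupp.degree_apply, Polynomial.algebraMap_apply, mul_assoc]
    have h2 : (MvPolynomial.monomial c a).IsHomogeneous c.degree :=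
      MvPolynomial.isHomogeneous_monomial a rfl
    rw [h1, Polynomial.coeff_monomial, MvPolynomial.homogeneousComponent_of_mem h2]
    by_cases h : c.degree = N
    · simp [h]
    · simp [h, Ne.symm h]
  | add p q hp hq => simp only [map_add, Polynomial.coeff_add, hp, hq]

variable (k : Type*) [Field k] {n : ℕ} (m : Fin n → ℕ)

/-- The homomorphism `k[x₀, …, xₙ₋₁] → A[𝔪T]`, `xᵢ ↦ t ^ mᵢ T`. -/
def toRees : MvPolynomial (Fin n) k →ₐ[k] reesAlgebra (maxIdeal k m) :=
  MvPolynomial.aeval fun i => ⟨Polynomial.monomial 1 (generator k m i),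
    reesAlgebra.monomial_mem.2 (generator_mem k m i)⟩

variable {k} in
theorem coeff_toRees (f : MvPolynomial (Fin n) k) (N : ℕ) :
    (toRees k m f : Polynomial (localRing k m)).coeff N =
      MvPolynomial.aeval (generator k m) (MvPolynomial.homogeneousComponent N f) := by
  rw [← coeff_aeval_monomial_one]
  congr 1
  change ((reesAlgebra (maxIdeal k m)).val.restrictScalars k).comp (toRees k m) f = _
  congr 1
  ext i : 1
  simp [toRees]

/-- The homomorphism `k[x₀, …, xₙ₋₁] → gr(A)` sending `xᵢ` to the class of `t ^ mᵢ`. -/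
def toAssociatedGraded :
    MvPolynomial (Fin n) k →ₐ[k] AssociatedGradedRing (maxIdeal k m) :=
  (Ideal.Quotient.mkₐ k _).comp (toRees k m)

theorem toAssociatedGraded_X (i : Fin n) : toAssociatedGraded k m (MvPolynomial.X i) =
    toGraded (maxIdeal k m) 1 (generator k m i) (generator_mem k m i) := by
  simp [toAssociatedGraded, toRees, toGraded]

variable {k} in
theorem coe_aeval_generator (f : MvPolynomial (Fin n) k) :
    (MvPolynomial.aeval (generator k m) f : PowerSeries k) =
      (parametrization k m f : PowerSeries k) := by
  change (localRing k m).val.comp (MvPolynomial.aeval (generator k m)) f =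
    (Polynomial.coeToPowerSeries.algHom k).comp (parametrization k m) f
  congr 1
  ext i : 1
  simp [generator, parametrization, Polynomial.coeToPowerSeries.algHom_apply]

variable {k m} in
/-- The kernel of `k[x₀, …, xₙ₋₁] → gr(A)` in terms of exponents. -/
theorem mem_ker_toAssociatedGraded_iff {f : MvPolynomial (Fin n) k} :
    f ∈ RingHom.ker (toAssociatedGraded k m) ↔
      ∀ N j, (parametrization k m (MvPolynomial.homogeneousComponent N f)).coeff j ≠ 0 →
        j ∈ exponentsOfOrder m (N + 1) := by
  rw [RingHom.mem_ker]
  change Ideal.Quotient.mk _ (toRees k m f) = 0 ↔ _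
  -- Vanishing in the graded ring is tested one power of `T` at a time, and each test is a support
  -- condition by `maxIdeal_pow`.
  rw [Ideal.Quotient.eq_zero_iff_mem, mem_map_algebraMap_reesAlgebra_iff]
  simp only [coeff_toRees, maxIdeal_pow, mem_supportIdeal, coe_aeval_generator,
    Polynomial.coeff_coe]

variable {k} in
theorem parametrization_monomial (c : Fin n →₀ ℕ) (a : k) :
    parametrization k m (MvPolynomial.monomial c a) =
      Polynomial.monomial (Finsupp.weight m c) a := by
  rw [parametrization, MvPolynomial.aeval_monomial, ← Polynomial.C_mul_X_pow_eq_monomial,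
    Finsupp.weight_apply, Polynomial.algebraMap_eq]
  simp only [Finsupp.prod, Finsupp.sum, ← pow_mul, Finset.prod_pow_eq_pow_sum, smul_eq_mul, mul_comm]

variable {k m} in
theorem exists_weight_eq_of_coeff_parametrization_ne_zero {f : MvPolynomial (Fin n) k} {j : ℕ}
    (hj : (parametrization k m f).coeff j ≠ 0) : ∃ c ∈ f.support, Finsupp.weight m c = j := by
  rw [f.as_sum, map_sum, Polynomial.finsetSum_coeff] at hj
  obtain ⟨c, hc, hne⟩ := Finset.exists_ne_zero_of_sum_ne_zero hj
  refine ⟨c, hc, ?_⟩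
  rw [parametrization_monomial, Polynomial.coeff_monomial] at hne
  by_contra h
  simp [h] at hne

-- Each exponent of the image of `f` is also the weight of a monomial of degree above `N`. The
-- combination `g` of these monomials has the same image as `f`, so `f - g` lies in `I(C)` and its
-- least form is `f`.
variable {k m} in
theorem isHomogeneous_mem_tangentConeIdeal {f : MvPolynomial (Fin n) k} {N : ℕ}
    (hf : f.IsHomogeneous N)
    (h : ∀ j, (parametrization k m f).coeff j ≠ 0 → j ∈ exponentsOfOrder m (N + 1)) :
    f ∈ tangentConeIdeal k m := by
  by_cases hf0 : f = 0
  · rw [hf0]; exact zero_mem _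
  choose! c hc hcj using h
  let p := parametrization k m f
  let g : MvPolynomial (Fin n) k := ∑ j ∈ p.support, MvPolynomial.monomial (c j) (p.coeff j)
  have hg : parametrization k m g = p := by
    simp only [g, map_sum, parametrization_monomial]
    refine (Finset.sum_congr rfl fun j hj => ?_).trans p.as_sum_support.symm
    rw [hcj j (Polynomial.mem_support_iff.1 hj)]
  have hgN : ∀ M ≤ N, MvPolynomial.homogeneousComponent M g = 0 := by
    intro M hM
    simp only [g, map_sum]
    refine Finset.sum_eq_zero fun j hj => ?_
    rw [MvPolynomial.homogeneousComponent_of_mem (MvPolynomial.isHomogeneous_monomial _ rfl),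
      if_neg]
    have := hc j (Polynomial.mem_support_iff.1 hj)
    omega
  have hleast : leastForm (f - g) = f := by
    have hN : MvPolynomial.homogeneousComponent N (f - g) = f := by
      rw [map_sub, hgN N le_rfl, sub_zero, MvPolynomial.homogeneousComponent_eq_self hf]
    have : IsLeast {j | MvPolynomial.homogeneousComponent j (f - g) ≠ 0} N := by
      refine ⟨by simpa only [Set.mem_ofPred_eq, hN] using hf0, fun j hj => ?_⟩
      by_contra! hlt
      refine hj ?_
      rw [map_sub, hgN j hlt.le, sub_zero, MvPolynomial.homogeneousComponent_of_mem hf,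
        if_neg hlt.ne]
    rw [leastForm, this.csInf_eq, hN]
  refine Ideal.subset_span ⟨f - g, ?_, hleast⟩
  change parametrization k m (f - g) = 0
  rw [map_sub, hg, sub_self]

variable {k m} in
theorem aeval_generator_mem_maxIdeal_pow {f : MvPolynomial (Fin n) k} {N : ℕ}
    (hf : ∀ M < N, MvPolynomial.homogeneousComponent M f = 0) :
    MvPolynomial.aeval (generator k m) f ∈ maxIdeal k m ^ N := by
  rw [← MvPolynomial.sum_homogeneousComponent f, map_sum]
  refine sum_mem fun M _ => ?_
  rcases lt_or_ge M N with h | h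
  · rw [hf M h, map_zero]; exact zero_mem _
  · rw [← coeff_toRees]
    exact Ideal.pow_le_pow_right h ((toRees k m f).2 M)

-- Since `f` maps to 0 in `A`, its least form has the same image as minus the remaining terms, which
-- have degree above `N` and so map into the power `N + 1` of the maximal ideal.
variable {k m} in
theorem leastForm_mem_ker_toAssociatedGraded {f : MvPolynomial (Fin n) k}
    (hf : f ∈ definingIdeal k m) : leastForm f ∈ RingHom.ker (toAssociatedGraded k m) := by
  rw [leastForm]
  set N := sInf {j : ℕ | MvPolynomial.homogeneousComponent j f ≠ 0} with hN
  set g := MvPolynomial.homogeneousComponent N f with hg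
  have hgN : g.IsHomogeneous N := MvPolynomial.homogeneousComponent_isHomogeneous N f
  have hmem : MvPolynomial.aeval (generator k m) (f - g) ∈ maxIdeal k m ^ (N + 1) := by
    refine aeval_generator_mem_maxIdeal_pow fun M hM => ?_
    rw [map_sub, MvPolynomial.homogeneousComponent_of_mem hgN]
    split_ifs with h
    · rw [h, hg, sub_self]
    · have : M ∉ {j : ℕ | MvPolynomial.homogeneousComponent j f ≠ 0} :=
        Nat.notMem_of_lt_sInf (by omega)
      rw [sub_zero]
      simpa using this
  have hf0 : MvPolynomial.aeval (generator k m) f = 0 := by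
    apply Subtype.ext
    rw [coe_aeval_generator, show parametrization k m f = 0 from hf]
    simp
  rw [map_sub, hf0, zero_sub, neg_mem_iff, maxIdeal_pow, mem_supportIdeal] at hmem
  simp only [coe_aeval_generator, Polynomial.coeff_coe] at hmem
  rw [mem_ker_toAssociatedGraded_iff]
  intro M j hj
  rw [MvPolynomial.homogeneousComponent_of_mem hgN] at hj
  split_ifs at hj with h
  · exact h ▸ hmem j hj
  · simp at hj

/-- The ideal of the tangent cone is the kernel of `k[x₀, …, xₙ₋₁] → gr(A)`. -/
theorem ker_toAssociatedGraded :
    RingHom.ker (toAssociatedGraded k m) = tangentConeIdeal k m := by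
  refine le_antisymm (fun f hf => ?_) (Ideal.span_le.2 ?_)
  · rw [mem_ker_toAssociatedGraded_iff] at hf
    rw [← MvPolynomial.sum_homogeneousComponent f]
    exact sum_mem fun N _ => isHomogeneous_mem_tangentConeIdeal
      (MvPolynomial.homogeneousComponent_isHomogeneous N f) (hf N)
  · rintro _ ⟨f, hf, rfl⟩
    exact leastForm_mem_ker_toAssociatedGraded hf

-- A nonzero exponent in the semigroup is a sum of at least one generator; thus `A` is `k` plus its
-- maximal ideal.
variable {k m} in
theorem sub_algebraMap_mem_maxIdeal (x : localRing k m) :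
    x - algebraMap k (localRing k m) (PowerSeries.constantCoeff (x : PowerSeries k)) ∈
      maxIdeal k m := by
  rw [← pow_one (maxIdeal k m), maxIdeal_pow]
  intro j hj
  have hj0 : j ≠ 0 := by
    rintro rfl
    simp at hj
  obtain ⟨c, -, rfl⟩ := (mem_exponentSemigroup_iff m).1
    ((x - algebraMap k (localRing k m) _).2 j hj)
  refine ⟨c, Nat.one_le_iff_ne_zero.2 fun h => hj0 ?_, rfl⟩
  rw [(Finsupp.degree_eq_zero_iff c).1 h, map_zero]

/-- The Rees algebra is generated over `A` in degree one. Modulo the extended ideal, elements of `A`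
reduce to constants, and degree-one elements to `k`-combinations of the generator classes. -/
theorem toAssociatedGraded_surjective : Function.Surjective (toAssociatedGraded k m) := by
  rw [← AlgHom.range_eq_top, eq_top_iff]
  set T := (toAssociatedGraded k m).range
  have hA : ∀ x : localRing k m,
      (Ideal.Quotient.mk ((maxIdeal k m).map (algebraMap _ (reesAlgebra (maxIdeal k m)))))
        (algebraMap (localRing k m) (reesAlgebra (maxIdeal k m)) x) ∈ T := by
    intro x
    have := Ideal.Quotient.eq.2 ((map_sub (algebraMap (localRing k m)
      (reesAlgebra (maxIdeal k m))) _ _) ▸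
        Ideal.mem_map_of_mem (algebraMap _ (reesAlgebra (maxIdeal k m)))
          (sub_algebraMap_mem_maxIdeal x))
    rw [this]
    exact T.algebraMap_mem (PowerSeries.constantCoeff (x : PowerSeries k))
  have hm : ∀ x ∈ maxIdeal k m, ∀ h : Polynomial.monomial 1 x ∈ reesAlgebra (maxIdeal k m),
      (Ideal.Quotient.mk ((maxIdeal k m).map (algebraMap _ (reesAlgebra (maxIdeal k m)))))
        ⟨Polynomial.monomial 1 x, h⟩ ∈ T := by
    intro x hx
    induction hx using Submodule.span_induction with
    | mem x hx =>
      obtain ⟨i, rfl⟩ := hx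
      exact fun h => ⟨MvPolynomial.X i, toAssociatedGraded_X k m i⟩
    | zero =>
      intro h
      have : (⟨Polynomial.monomial 1 0, h⟩ : reesAlgebra (maxIdeal k m)) = 0 :=
        Subtype.ext (map_zero _)
      rw [this, map_zero]
      exact zero_mem T
    | add x y hx hy ihx ihy =>
      intro h
      have hx' := reesAlgebra.monomial_mem.2 ((pow_one (maxIdeal k m)).ge hx)
      have hy' := reesAlgebra.monomial_mem.2 ((pow_one (maxIdeal k m)).ge hy)
      have : (⟨Polynomial.monomial 1 (x + y), h⟩ : reesAlgebra (maxIdeal k m)) =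
          ⟨Polynomial.monomial 1 x, hx'⟩ + ⟨Polynomial.monomial 1 y, hy'⟩ :=
        Subtype.ext (map_add _ _ _)
      rw [this, map_add]
      exact add_mem (ihx _) (ihy _)
    | smul a x hx ih =>
      intro h
      have hx' := reesAlgebra.monomial_mem.2 ((pow_one (maxIdeal k m)).ge hx)
      have : (⟨Polynomial.monomial 1 (a • x), h⟩ : reesAlgebra (maxIdeal k m)) =
          algebraMap _ (reesAlgebra (maxIdeal k m)) a * ⟨Polynomial.monomial 1 x, hx'⟩ := by
        apply Subtype.ext
        change Polynomial.monomial 1 (a * x) = Polynomial.C a * Polynomial.monomial 1 x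
        rw [Polynomial.C_mul_monomial]
      rw [this, map_mul]
      exact mul_mem (hA a) (ih _)
  have hT : ∀ y ∈ Algebra.adjoin (localRing k m) (Submodule.map
      (Polynomial.monomial 1 : localRing k m →ₗ[localRing k m] Polynomial (localRing k m))
        (maxIdeal k m) : Set (Polynomial (localRing k m))),
      ∀ h : y ∈ reesAlgebra (maxIdeal k m),
      (Ideal.Quotient.mk ((maxIdeal k m).map (algebraMap _ (reesAlgebra (maxIdeal k m)))))
        ⟨y, h⟩ ∈ T := by
    intro y hy
    induction hy using Algebra.adjoin_induction with
    | mem y hy =>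
      obtain ⟨x, hx, rfl⟩ := hy
      exact hm x hx
    | algebraMap r => exact fun _ => hA r
    | add x y hx hy ihx ihy =>
      intro h
      rw [adjoin_monomial_eq_reesAlgebra] at hx hy
      exact add_mem (ihx hx) (ihy hy)
    | mul x y hx hy ihx ihy =>
      intro h
      rw [adjoin_monomial_eq_reesAlgebra] at hx hy
      exact mul_mem (ihx hx) (ihy hy)
  intro z _
  obtain ⟨y, rfl⟩ := Ideal.Quotient.mk_surjective z
  exact hT y (by rw [adjoin_monomial_eq_reesAlgebra]; exact y.2) y.2

/-- The coordinate ring of the tangent cone is the associated graded ring of `A`. -/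
def tangentConeEquiv :
    (MvPolynomial (Fin n) k ⧸ tangentConeIdeal k m) ≃ₐ[k]
      AssociatedGradedRing (maxIdeal k m) :=
  (Ideal.quotientEquivAlgOfEq k (ker_toAssociatedGraded k m).symm).trans
    (Ideal.quotientKerAlgEquivOfSurjective (toAssociatedGraded_surjective k m))

theorem tangentConeEquiv_mk (f : MvPolynomial (Fin n) k) :
    tangentConeEquiv k m (Ideal.Quotient.mk _ f) = toAssociatedGraded k m f := by
  simp [tangentConeEquiv]

end TangentCone

/-! ### Torsion-freeness and finiteness over the polynomial ring in one variable. -/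

section CohenMacaulayTangentCone

theorem homogeneousComponent_X_mul {k σ : Type*} [CommSemiring k] (i : σ) (f : MvPolynomial σ k)
    (N : ℕ) : MvPolynomial.homogeneousComponent (N + 1) (MvPolynomial.X i * f) =
      MvPolynomial.X i * MvPolynomial.homogeneousComponent N f := by
  have h := coeff_aeval_monomial_one (k := k) (σ := σ) (R := MvPolynomial σ k) MvPolynomial.X
  simp only [MvPolynomial.aeval_X_left, AlgHom.coe_id, id_eq] at h
  rw [← h, ← h, map_mul, MvPolynomial.aeval_X, Polynomial.coeff_monomial_mul]

/-- The leading coefficient of `p(xT)` is a unit times a power of `x`. -/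
theorem aeval_monomial_one_mem_nonZeroDivisors {k B : Type*} [Field k] [CommRing B] [Algebra k B]
    {x : B} (hx : x ∈ nonZeroDivisors B) {p : Polynomial k} (hp : p ≠ 0) :
    Polynomial.aeval (Polynomial.monomial 1 x) p ∈ nonZeroDivisors (Polynomial B) := by
  nontriviality B
  set q := Polynomial.aeval (Polynomial.monomial 1 x) p with hq
  have hqc : ∀ N, q.coeff N = algebraMap k B (p.coeff N) * x ^ N := by
    intro N
    rw [← Polynomial.coeff_map, ← Polynomial.comp_C_mul_X_coeff, Polynomial.comp,
      Polynomial.eval₂_map, Polynomial.C_mul_X_eq_monomial]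
    rfl
  have hlead : q.coeff p.natDegree ∈ nonZeroDivisors B := by
    rw [hqc]
    refine mul_mem (IsUnit.mem_nonZeroDivisors ?_) (pow_mem hx _)
    exact (IsUnit.mk0 _ (Polynomial.leadingCoeff_ne_zero.2 hp)).map _
  refine Polynomial.mem_nonZeroDivisors_of_leadingCoeff ?_
  have : q.natDegree = p.natDegree := by
    refine le_antisymm (Polynomial.natDegree_le_iff_coeff_eq_zero.2 fun N hN => ?_)
      (Polynomial.le_natDegree_of_ne_zero (nonZeroDivisors.ne_zero hlead))
    rw [hqc, Polynomial.coeff_eq_zero_of_natDegree_lt hN, map_zero, zero_mul]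
  rwa [Polynomial.leadingCoeff, this]

variable (k : Type*) [Field k] {n : ℕ} (m : Fin n → ℕ)

-- The kernel description is a condition on each component separately, so the ideal is homogeneous.
variable {k m} in
theorem homogeneousComponent_mem_tangentConeIdeal {f : MvPolynomial (Fin n) k}
    (hf : f ∈ tangentConeIdeal k m) (N : ℕ) :
    MvPolynomial.homogeneousComponent N f ∈ tangentConeIdeal k m := by
  rw [← ker_toAssociatedGraded] at hf ⊢
  rw [mem_ker_toAssociatedGraded_iff] at hf ⊢
  intro M j hj
  rw [MvPolynomial.homogeneousComponent_of_mem
    (MvPolynomial.homogeneousComponent_isHomogeneous N f)] at hj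
  split_ifs at hj with h
  · exact h ▸ hf N j hj
  · simp at hj

/-- If `xᵢ` is a nonzerodivisor on the coordinate ring of the tangent cone, then so is every nonzero
polynomial in `xᵢ`. -/
theorem aeval_mk_X_mem_nonZeroDivisors (i : Fin n)
    (hi : ∀ f, MvPolynomial.X i * f ∈ tangentConeIdeal k m → f ∈ tangentConeIdeal k m)
    {p : Polynomial k} (hp : p ≠ 0) :
    Polynomial.aeval (Ideal.Quotient.mk (tangentConeIdeal k m) (MvPolynomial.X i)) p ∈
      nonZeroDivisors (MvPolynomial (Fin n) k ⧸ tangentConeIdeal k m) := by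
  set K := tangentConeIdeal k m
  have hx : Ideal.Quotient.mk K (MvPolynomial.X i) ∈
      nonZeroDivisors (MvPolynomial (Fin n) k ⧸ K) := by
    rw [mem_nonZeroDivisors_iff_right]
    intro b hb
    obtain ⟨f, rfl⟩ := Ideal.Quotient.mk_surjective b
    rw [← map_mul, Ideal.Quotient.eq_zero_iff_mem, mul_comm] at hb
    exact Ideal.Quotient.eq_zero_iff_mem.2 (hi f hb)
  -- Recording degrees in `T`: as `K` is homogeneous, `γ` has kernel exactly `K`, and it turns
  -- `p(xᵢ)` into `p(xᵢT)`, to which the leading coefficient argument applies.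
  let γ : MvPolynomial (Fin n) k →ₐ[k] Polynomial (MvPolynomial (Fin n) k ⧸ K) :=
    MvPolynomial.aeval fun l => Polynomial.monomial 1 (Ideal.Quotient.mk K (MvPolynomial.X l))
  have hγ : ∀ f N, (γ f).coeff N =
      Ideal.Quotient.mk K (MvPolynomial.homogeneousComponent N f) := by
    intro f N
    rw [coeff_aeval_monomial_one]
    change _ = Ideal.Quotient.mkₐ k K _
    congr 1
    ext l
    simp
  have hγ0 : ∀ f, γ f = 0 ↔ f ∈ K := by
    intro f
    constructor
    · intro h
      rw [← MvPolynomial.sum_homogeneousComponent f]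
      refine sum_mem fun N _ => ?_
      rw [← Ideal.Quotient.eq_zero_iff_mem, ← hγ, h, Polynomial.coeff_zero]
    · intro h
      ext N
      rw [hγ, Polynomial.coeff_zero, Ideal.Quotient.eq_zero_iff_mem]
      exact homogeneousComponent_mem_tangentConeIdeal h N
  have hq : γ (Polynomial.aeval (MvPolynomial.X i) p) =
      Polynomial.aeval (Polynomial.monomial 1 (Ideal.Quotient.mk K (MvPolynomial.X i))) p := by
    rw [← Polynomial.aeval_algHom_apply, MvPolynomial.aeval_X]
  rw [mem_nonZeroDivisors_iff_right]
  intro b hb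
  obtain ⟨f, rfl⟩ := Ideal.Quotient.mk_surjective b
  have hpx : Polynomial.aeval (Ideal.Quotient.mk K (MvPolynomial.X i)) p =
      Ideal.Quotient.mk K (Polynomial.aeval (MvPolynomial.X i) p) :=
    Polynomial.aeval_algHom_apply (Ideal.Quotient.mkₐ k K) _ p
  rw [hpx, ← map_mul, Ideal.Quotient.eq_zero_iff_mem, ← hγ0, map_mul] at hb
  rw [hq] at hb
  exact Ideal.Quotient.eq_zero_iff_mem.2 ((hγ0 f).1
    ((mul_right_mem_nonZeroDivisors_eq_zero_iff
      (aeval_monomial_one_mem_nonZeroDivisors hx hp)).1 hb))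

/-- If all variables but `xᵢ` are nilpotent modulo the ideal of the tangent cone, then its
coordinate ring is finite over `k[xᵢ]`. -/
theorem finite_aeval_mk_X (i : Fin n)
    (hnil : ∀ l ≠ i, ∃ N, 0 < N ∧ MvPolynomial.X l ^ N ∈ tangentConeIdeal k m) :
    (Polynomial.aeval (R := k) (Ideal.Quotient.mk (tangentConeIdeal k m)
      (MvPolynomial.X i))).toRingHom.Finite := by
  set K := tangentConeIdeal k m
  set φ := (Polynomial.aeval (R := k) (Ideal.Quotient.mk K (MvPolynomial.X i))).toRingHom with hφ
  have hft : φ.FiniteType := by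
    refine RingHom.FiniteType.of_comp_finiteType (f := Polynomial.C) ?_
    have : φ.comp Polynomial.C = algebraMap k (MvPolynomial (Fin n) k ⧸ K) := by
      ext a
      simp [hφ]
    rw [this, RingHom.finiteType_algebraMap]
    infer_instance
  refine RingHom.finite_iff_isIntegral_and_finiteType.2 ⟨?_, hft⟩
  algebraize [φ]
  intro b
  change IsIntegral (Polynomial k) b
  obtain ⟨f, rfl⟩ := Ideal.Quotient.mk_surjective b
  induction f using MvPolynomial.induction_on with
  | C a =>
    have : Ideal.Quotient.mk K (MvPolynomial.C a) = φ (Polynomial.C a) := by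
      simp only [hφ, AlgHom.toRingHom_eq_coe, RingHom.coe_coe, Polynomial.aeval_C]
      rfl
    rw [this]
    exact isIntegral_algebraMap
  | add p q hp hq => rw [map_add]; exact hp.add hq
  | mul_X p l hp =>
    rw [map_mul]
    refine hp.mul ?_
    by_cases hl : l = i
    · have : Ideal.Quotient.mk K (MvPolynomial.X l) = φ Polynomial.X := by simp [hφ, hl]
      rw [this]
      exact isIntegral_algebraMap
    · obtain ⟨N, hN, hmem⟩ := hnil l hl
      refine IsIntegral.of_pow hN ?_
      rw [← map_pow, Ideal.Quotient.eq_zero_iff_mem.2 hmem]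
      exact isIntegral_zero

/-! ### Arithmetic progressions with four terms. -/

section Arithmetic

variable {m : Fin 4 → ℕ} {d : ℕ}

theorem weight_eq_of_arithmetic
    (harith : ∀ i : Fin 4, m i = m 0 + (i : ℕ) * d) (c : Fin 4 →₀ ℕ) :
    ∃ j ≤ 3 * c.degree, Finsupp.weight m c = c.degree * m 0 + j * d := by
  refine ⟨c 1 + 2 * c 2 + 3 * c 3, ?_, ?_⟩
  · simp only [Finsupp.degree_eq_sum, Fin.sum_univ_four]
    omega
  · rw [Finsupp.weight_apply, Finsupp.sum_fintype _ _ (by simp), Finsupp.degree_eq_sum,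
      Fin.sum_univ_four, Fin.sum_univ_four, harith 1, harith 2, harith 3]
    simp only [smul_eq_mul, Fin.val_one, Fin.val_two, show ((3 : Fin 4) : ℕ) = 3 from rfl]
    ring

theorem mem_exponentsOfOrder_of_arithmetic
    (harith : ∀ i : Fin 4, m i = m 0 + (i : ℕ) * d) {N j : ℕ} (hj : j ≤ 3 * N) :
    N * m 0 + j * d ∈ exponentsOfOrder m N := by
  induction N generalizing j with
  | zero => exact ⟨0, by simp, by simp; omega⟩
  | succ N ih =>
    -- Greedy choice: the new summand takes as many of the `j` steps as possible, at most 3.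
    obtain ⟨i, l, hl, rfl⟩ : ∃ (i : Fin 4) (l : ℕ), l ≤ 3 * N ∧ l + (i : ℕ) = j :=
      ⟨⟨min j 3, by omega⟩, j - min j 3, by omega, by simp only; omega⟩
    convert add_mem_exponentsOfOrder (ih hl) (self_mem_exponentsOfOrder_one m i) using 1
    rw [harith i]
    ring

/-- The first term of an arithmetic progression behaves like a nonzerodivisor for the order. -/
theorem mem_exponentsOfOrder_succ_of_add_mem
    (harith : ∀ i : Fin 4, m i = m 0 + (i : ℕ) * d)
    (hcop : Nat.Coprime d (m 0)) (hd : 0 < d)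
    (c : Fin 4 →₀ ℕ) (h : Finsupp.weight m c + m 0 ∈ exponentsOfOrder m (c.degree + 2)) :
    Finsupp.weight m c ∈ exponentsOfOrder m (c.degree + 1) := by
  obtain ⟨e, he, heq⟩ := h
  obtain ⟨j, hj, hcj⟩ := weight_eq_of_arithmetic harith c
  obtain ⟨l, hl, hel⟩ := weight_eq_of_arithmetic harith e
  obtain ⟨r, hr⟩ := exists_add_of_le he
  rw [hcj] at heq ⊢
  rw [hel, hr] at heq
  -- Comparing both expressions forces `d` to divide `r + 1`, say `r + 1 = d * q` with `q` positive.
  -- Trading `q * m 0` steps of size `d` for `d * q` copies of `m 0` rewrites the weight with more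
  -- summands, and `l ≤ j` keeps the step count admissible.
  have h1 : (r + 1) * m 0 + l * d = j * d := by linarith
  have hdvd : d ∣ (r + 1) * m 0 := by
    rw [← Nat.dvd_add_left (Dvd.intro_left l rfl), h1]
    exact Dvd.intro_left j rfl
  obtain ⟨q, hq⟩ := hcop.dvd_of_dvd_mul_right hdvd
  have h2 : q * m 0 + l = j := by
    apply Nat.eq_of_mul_eq_mul_right hd
    rw [← h1, hq]
    ring
  have hqpos : 1 ≤ d * q := by omega
  have h3 : c.degree * m 0 + j * d = (c.degree + d * q) * m 0 + l * d := by
    rw [← h2]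
    ring
  rw [h3]
  refine exponentsOfOrder_anti (by omega) (mem_exponentsOfOrder_of_arithmetic harith ?_)
  have : l ≤ j := by omega
  omega

/-- Multiplying by `X 0` raises degree by 1 and exponents by `m 0`, so the kernel criterion reduces
the claim to the weights of single monomials. -/
theorem mem_tangentConeIdeal_of_X_zero_mul
    (harith : ∀ i : Fin 4, m i = m 0 + (i : ℕ) * d)
    (hcop : Nat.Coprime d (m 0)) (hd : 0 < d)
    (f : MvPolynomial (Fin 4) k) (hf : MvPolynomial.X 0 * f ∈ tangentConeIdeal k m) :
    f ∈ tangentConeIdeal k m := by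
  rw [← ker_toAssociatedGraded, mem_ker_toAssociatedGraded_iff] at hf ⊢
  intro N j hj
  obtain ⟨c, hc, rfl⟩ := exists_weight_eq_of_coeff_parametrization_ne_zero hj
  rw [MvPolynomial.support_homogeneousComponent, Finset.mem_filter] at hc
  rw [← hc.2]
  refine mem_exponentsOfOrder_succ_of_add_mem harith hcop hd c ?_
  rw [hc.2]
  refine hf (N + 1) _ ?_
  rw [homogeneousComponent_X_mul, map_mul]
  nth_rw 1 [parametrization]
  rwa [MvPolynomial.aeval_X, Polynomial.coeff_X_pow_mul]

theorem X_pow_mem_tangentConeIdeal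
    (harith : ∀ i : Fin 4, m i = m 0 + (i : ℕ) * d)
    (hd : 0 < d) {i : Fin 4} (hi : i ≠ 0) :
    (MvPolynomial.X i ^ m 0 : MvPolynomial (Fin 4) k) ∈ tangentConeIdeal k m := by
  refine isHomogeneous_mem_tangentConeIdeal (MvPolynomial.isHomogeneous_X_pow i (m 0)) fun j hj => ?_
  rw [parametrization, map_pow, MvPolynomial.aeval_X, ← pow_mul, Polynomial.coeff_X_pow] at hj
  obtain ⟨rfl, -⟩ := ite_ne_right_iff.1 hj
  have hi' : 0 < (i : ℕ) := Fin.pos_iff_ne_zero.2 hi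
  have hlt : m 0 + 1 ≤ m i := by
    rw [harith i]
    have := Nat.mul_pos hi' hd
    omega
  have := mem_exponentsOfOrder_of_arithmetic harith (N := m i) (j := 0) (Nat.zero_le _)
  rw [zero_mul, add_zero] at this
  exact exponentsOfOrder_anti hlt this

end Arithmetic

end CohenMacaulayTangentCone

end MonomialCurve

end

theorem theorem2p5 (k : Type*) [Field k] (m : Fin 4 → ℕ) (a b d : ℕ)
    (ha : 1 ≤ a) (hb : b ∈ Set.Icc 1 3) (hm0 : m 0 = 3 * a + b)
    (hmono : StrictMono m) (harith : ∀ i : Fin 4, m i = m 0 + (i : ℕ) * d)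
    (hgcd : Finset.univ.gcd m = 1) :
    (∃ e : (MvPolynomial (Fin 4) k ⧸ MonomialCurve.tangentConeIdeal k m) ≃ₐ[k]
        MonomialCurve.AssociatedGradedRing (MonomialCurve.maxIdeal k m),
      ∀ i : Fin 4, e (Ideal.Quotient.mk (MonomialCurve.tangentConeIdeal k m) (MvPolynomial.X i)) =
        MonomialCurve.toGraded (MonomialCurve.maxIdeal k m) 1 (MonomialCurve.generator k m i)
          (MonomialCurve.generator_mem k m i)) ∧
    MonomialCurve.IsCohenMacaulayRing
      (MvPolynomial (Fin 4) k ⧸ MonomialCurve.tangentConeIdeal k m) ∧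
    MonomialCurve.IsCohenMacaulayRing
      (MonomialCurve.AssociatedGradedRing (MonomialCurve.maxIdeal k m)) := by
  have hd : 0 < d := by
    have h01 : m 0 < m 1 := hmono (by decide)
    rw [harith 1] at h01
    by_contra h
    have hd0 : d = 0 := by omega
    simp [hd0] at h01
  have hcop : Nat.Coprime d (m 0) := by
    rw [Nat.coprime_iff_gcd_eq_one, ← Nat.dvd_one, ← hgcd]
    refine Finset.dvd_gcd fun i _ => ?_
    rw [harith i]
    exact dvd_add (Nat.gcd_dvd_right _ _) ((Nat.gcd_dvd_left _ _).mul_left _)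
  have hpos : 0 < m 0 := by omega
  have hreg := fun (p : Polynomial k) (hp : p ≠ 0) =>
    MonomialCurve.aeval_mk_X_mem_nonZeroDivisors k m 0
      (MonomialCurve.mem_tangentConeIdeal_of_X_zero_mul k harith hcop hd) hp
  have hfin := MonomialCurve.finite_aeval_mk_X k m 0 fun l hl =>
    ⟨m 0, hpos, MonomialCurve.X_pow_mem_tangentConeIdeal k harith hd hl⟩
  refine ⟨⟨MonomialCurve.tangentConeEquiv k m, fun i => ?_⟩, ?_, ?_⟩
  · rw [MonomialCurve.tangentConeEquiv_mk, MonomialCurve.toAssociatedGraded_X]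
  · exact MonomialCurve.isCohenMacaulayRing_of_finite _ hfin hreg
  -- Finiteness and torsion-freeness are transported along the isomorphism.
  · let e := (MonomialCurve.tangentConeEquiv k m).toRingEquiv
    refine MonomialCurve.isCohenMacaulayRing_of_finite (e.toRingHom.comp _)
      ((RingHom.Finite.of_surjective _ e.surjective).comp hfin) fun p hp => ?_
    have := Submonoid.mem_map_of_mem e (hreg p hp)
    rwa [MulEquivClass.map_nonZeroDivisors] at this
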